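/- Let $N\ge 1$, let $I_N=(0,1)^N$, and let $S_N=\{x\in\mathbb R^N : 0<x_1<\dots<x_N<1\}$. All functions are complex-valued. For open $\Omega\subset\mathbb R^N$ let $\mathrm H^1(\Omega)$ be the Sobolev space with norm $\|f\|_{\mathrm H^1}^2=\|f\|_{\mathrm L^2(\Omega)}^2+\|\nabla f\|_{\mathrm L^2(\Omega)}^2$. Let $\mathrm H^{1/2}(\partial I_N)$ be the space of functions $g$ on $\partial I_N$ with $$\int_{\partial I_N}|g|^2\,d\mathscr H^{N-1}+\int_{\partial I_N\times\partial I_N}\frac{|g(x)-g(y)|^2}{|x-y|^N}\,d\mathscr H^{N-1}(x)\,d\mathscr H^{N-1}(y)<\infty ,$$ normed by the square root of this expression (for $N=1$ it is $\mathbb C^2$, the functions on $\{0,1\}$), and let $\gamma:\mathrm H^1(I_N)\to\mathrm H^{1/2}(\partial I_N)$ be the Dirichlet trace operator, the unique continuous operator with $\gamma f=f|_{\partial I_N}$ for $f\in \mathrm H^1(I_N)\cap C(\overline{I_N})$. Let $L\subset\mathrm H^{1/2}(\partial I_N)$ be a closed subspace and $$\mathrm H^1_L(I_N)=\{\Psi\in\mathrm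 H^1(I_N):\gamma\Psi\in L\}.$$ Let $\mathcal H_N=\bigwedge^N\mathrm L^2(0,1)$ be the space of antisymmetric functions in $\mathrm L^2(I_N)$, i.e. those with $\Psi(x_{\sigma(1)},\dots,x_{\sigma(N)})=\mathrm{sgn}(\sigma)\Psi(x_1,\dots,x_N)$ for a.e. $x$ and every permutation $\sigma$ of $\{1,\dots,N\}$, and set $$\mathrm H^1_L(S_N)=\{\Psi|_{S_N}:\Psi\in\mathrm H^1_L(I_N)\cap\mathcal H_N\}\subset \mathrm H^1(S_N).$$ For a permutation $\sigma$ write $\sigma(x_1,\dots,x_N)=(x_{\sigma(1)},\dots,x_{\sigma(N)})$, and for a function $\Psi$ on $S_N$ let $\sigma_\#\Psi$ be the function equal to $\Psi\circ\sigma^{-1}$ on $\sigma(S_N)$ and to $0$ elsewhere. Then the map $$T\Psi=\frac1{\sqrt{N!}}\sum_{\sigma}\mathrm{sgn}(\sigma)\,\sigma_\#\Psi ,$$ the sum being over all permutations of $\{1,\dots,N\}$, is an isometric isomorphism (linear, bijective and norm-preserving) from $\mathrm H^1_L(S_N)$, with the norm of $\mathrm H^1(S_N)$, onto $\mathrm H^1_L(I_N)\cap\mathcal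 H_N$, with the norm of $\mathrm H^1(I_N)$. -/

import Mathlib

open MeasureTheory Set
open scoped ENNReal ContDiff

noncomputable section

namespace SimplexReduction

/-- Euclidean space `ℝ^d`. -/
abbrev E (d : ℕ) : Type := EuclideanSpace ℝ (Fin d)

/-! ### The Sobolev space `H¹(Ω)` -/

/-- The complex space `L²(Ω)`, for Lebesgue measure on `Ω ⊆ ℝ^d`. -/
abbrev L2 {d : ℕ} (Ω : Set (E d)) : Type := Lp ℂ 2 (volume.restrict Ω)

/-- The space `L²(Ω; ℂ^d)` of square integrable vector fields. -/
abbrev L2Vec {d : ℕ} (Ω : Set (E d)) : Type :=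
  Lp (EuclideanSpace ℂ (Fin d)) 2 (volume.restrict Ω)

/-- `G` is the weak gradient of `f` on `Ω`:
`∫_Ω f ∂ᵢφ = - ∫_Ω Gᵢ φ` for every test function `φ ∈ C_c^∞(Ω)` and every `i`. -/
def IsWeakGrad {d : ℕ} (Ω : Set (E d)) (f : E d → ℂ) (G : E d → EuclideanSpace ℂ (Fin d)) :
    Prop :=
  ∀ φ : E d → ℝ, ContDiff ℝ ∞ φ → HasCompactSupport φ → tsupport φ ⊆ Ω → ∀ i : Fin d,
    ∫ x in Ω, fderiv ℝ φ x (EuclideanSpace.single i 1) • f x = - ∫ x in Ω, φ x • G x i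

theorem integrable_test_smul {d : ℕ} {Ω : Set (E d)} {f : E d → ℂ} {ψ : E d → ℝ}
    (hf : MemLp f 2 (volume.restrict Ω)) (hψ : Continuous ψ) (hc : HasCompactSupport ψ) :
    Integrable (fun x => ψ x • f x) (volume.restrict Ω) :=
  memLp_one_iff_integrable.1
    (hf.smul (r := 1) ((hψ.memLp_of_hasCompactSupport (μ := volume) (p := 2) hc).restrict Ω))

theorem memLp_coord {d : ℕ} {Ω : Set (E d)} (G : L2Vec Ω) (i : Fin d) :
    MemLp (fun x => G x i) 2 (volume.restrict Ω) :=
  (EuclideanSpace.proj (𝕜 := ℂ) i).comp_memLp G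

theorem continuous_pderiv {d : ℕ} {φ : E d → ℝ} (h : ContDiff ℝ ∞ φ) (v : E d) :
    Continuous fun x => fderiv ℝ φ x v :=
  (h.continuous_fderiv (by simp)).clm_apply continuous_const

theorem hasCompactSupport_pderiv {d : ℕ} {φ : E d → ℝ} (h : HasCompactSupport φ) (v : E d) :
    HasCompactSupport fun x => fderiv ℝ φ x v :=
  (h.fderiv (𝕜 := ℝ)).comp_left (g := fun l : E d →L[ℝ] ℝ => l v) (by simp)

/-- The Sobolev space `H¹(Ω)` of complex-valued functions, realized as the space of pairs `(f, ∇f)`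
in the Hilbert sum `L²(Ω) ⊕ L²(Ω; ℂ^d)`, from which it inherits the norm
`‖f‖² = ‖f‖²_{L²} + ‖∇f‖²_{L²}`. (The weak gradient is determined by `f`, for `Ω` open.) -/
def H1 {d : ℕ} (Ω : Set (E d)) : Submodule ℂ (WithLp 2 (L2 Ω × L2Vec Ω)) where
  carrier := {u | IsWeakGrad Ω u.fst u.snd}
  zero_mem' := by
    intro φ _ _ _ i
    have h1 : ((0 : L2 Ω) : E d → ℂ) =ᵐ[volume.restrict Ω] 0 := Lp.coeFn_zero _ _ _
    have h2 : ((0 : L2Vec Ω) : E d → _) =ᵐ[volume.restrict Ω] 0 := Lp.coeFn_zero _ _ _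
    have e1 : ∫ x in Ω, fderiv ℝ φ x (EuclideanSpace.single i 1) • (0 : L2 Ω) x = 0 :=
      integral_eq_zero_of_ae (by filter_upwards [h1] with x hx; rw [hx]; simp)
    have e2 : ∫ x in Ω, φ x • (0 : L2Vec Ω) x i = 0 :=
      integral_eq_zero_of_ae (by filter_upwards [h2] with x hx; rw [hx]; simp)
    change ∫ x in Ω, fderiv ℝ φ x (EuclideanSpace.single i 1) • (0 : L2 Ω) x
      = - ∫ x in Ω, φ x • (0 : L2Vec Ω) x i
    rw [e1, e2, neg_zero]
  add_mem' := by
    intro u v hu hv φ h1 h2 h3 i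
    have e1 : ∫ x in Ω, fderiv ℝ φ x (EuclideanSpace.single i 1) • (u.fst + v.fst) x
        = (∫ x in Ω, fderiv ℝ φ x (EuclideanSpace.single i 1) • u.fst x)
          + ∫ x in Ω, fderiv ℝ φ x (EuclideanSpace.single i 1) • v.fst x := by
      rw [← integral_add]
      · refine integral_congr_ae ?_
        filter_upwards [Lp.coeFn_add u.fst v.fst] with x hx
        simp only [hx, Pi.add_apply, smul_add]
      · exact integrable_test_smul (Lp.memLp _) (continuous_pderiv h1 _)
          (hasCompactSupport_pderiv h2 _)
      · exact integrable_test_smul (Lp.memLp _) (continuous_pderiv h1 _)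
          (hasCompactSupport_pderiv h2 _)
    have e2 : ∫ x in Ω, φ x • (u.snd + v.snd) x i
        = (∫ x in Ω, φ x • u.snd x i) + ∫ x in Ω, φ x • v.snd x i := by
      rw [← integral_add]
      · refine integral_congr_ae ?_
        filter_upwards [Lp.coeFn_add u.snd v.snd] with x hx
        simp only [hx, Pi.add_apply, PiLp.add_apply, smul_add]
      · exact integrable_test_smul (memLp_coord _ i) h1.continuous h2
      · exact integrable_test_smul (memLp_coord _ i) h1.continuous h2
    change ∫ x in Ω, fderiv ℝ φ x (EuclideanSpace.single i 1) • (u.fst + v.fst) x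
      = - ∫ x in Ω, φ x • (u.snd + v.snd) x i
    rw [e1, e2, hu φ h1 h2 h3 i, hv φ h1 h2 h3 i]
    ring
  smul_mem' := by
    intro c u hu φ h1 h2 h3 i
    have e1 : ∫ x in Ω, fderiv ℝ φ x (EuclideanSpace.single i 1) • (c • u.fst) x
        = c • ∫ x in Ω, fderiv ℝ φ x (EuclideanSpace.single i 1) • u.fst x := by
      rw [← integral_smul]
      refine integral_congr_ae ?_
      filter_upwards [Lp.coeFn_smul c u.fst] with x hx
      rw [hx, Pi.smul_apply, smul_comm]
    have e2 : ∫ x in Ω, φ x • (c • u.snd) x i = c • ∫ x in Ω, φ x • u.snd x i := by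
      rw [← integral_smul]
      refine integral_congr_ae ?_
      filter_upwards [Lp.coeFn_smul c u.snd] with x hx
      rw [hx, Pi.smul_apply, PiLp.smul_apply, smul_comm]
    change ∫ x in Ω, fderiv ℝ φ x (EuclideanSpace.single i 1) • (c • u.fst) x
      = - ∫ x in Ω, φ x • (c • u.snd) x i
    rw [e1, e2, hu φ h1 h2 h3 i, smul_neg]

/-- The inclusion `H¹(Ω) → L²(Ω)`. -/
def toL2 {d : ℕ} (Ω : Set (E d)) : H1 Ω →ₗ[ℂ] L2 Ω where
  toFun u := (u : WithLp 2 (L2 Ω × L2Vec Ω)).fst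
  map_add' _ _ := rfl
  map_smul' _ _ := rfl

/-! ### The boundary space `H^{1/2}(∂Ω)` and the trace -/

/-- The `(d-1)`-dimensional Hausdorff measure on the boundary of `Ω ⊆ ℝ^d`. -/
def surface {d : ℕ} (Ω : Set (E d)) : Measure (E d) :=
  (Measure.hausdorffMeasure ((d : ℝ) - 1)).restrict (frontier Ω)

/-- The measure `|x - y|^{-d} dS(x) dS(y)` on `∂Ω × ∂Ω`. -/
def gagliardo {d : ℕ} (Ω : Set (E d)) : Measure (E d × E d) :=
  ((surface Ω).prod (surface Ω)).withDensity fun p => (edist p.1 p.2 ^ d)⁻¹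

/-- The space `H^{1/2}(∂Ω)`: an element is a class `g ∈ L²(∂Ω)` for which
`(x, y) ↦ g x - g y` is square integrable against `|x - y|^{-d} dS(x) dS(y)`. It is realized as the
space of the pairs of these two functions in the Hilbert sum of the two `L²` spaces, from which it
inherits the norm
`‖g‖² = ∫ |g|² dS + ∫∫ |g x - g y|² / |x - y|^d dS(x) dS(y)`. -/
def H12 {d : ℕ} (Ω : Set (E d)) :
    Submodule ℂ (WithLp 2 (Lp ℂ 2 (surface Ω) × Lp ℂ 2 (gagliardo Ω))) where
  carrier := {u | ∃ g : E d → ℂ, u.fst =ᵐ[surface Ω] g ∧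
    u.snd =ᵐ[gagliardo Ω] fun p => g p.1 - g p.2}
  zero_mem' := by
    refine ⟨0, Lp.coeFn_zero _ _ _, ?_⟩
    refine (Lp.coeFn_zero ℂ 2 (gagliardo Ω)).trans (ae_of_all _ fun p => ?_)
    simp
  add_mem' := by
    rintro u v ⟨g, h1, h2⟩ ⟨k, h3, h4⟩
    refine ⟨g + k, (Lp.coeFn_add u.fst v.fst).trans (h1.add h3), ?_⟩
    refine (Lp.coeFn_add u.snd v.snd).trans ?_
    filter_upwards [h2, h4] with p hp hq
    simp only [Pi.add_apply, hp, hq]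
    ring
  smul_mem' := by
    rintro c u ⟨g, h1, h2⟩
    refine ⟨c • g, (Lp.coeFn_smul c u.fst).trans (h1.const_smul c), ?_⟩
    refine (Lp.coeFn_smul c u.snd).trans ?_
    filter_upwards [h2] with p hp
    simp only [Pi.smul_apply, hp, smul_sub]

/-- The graph of the classical restriction `F ↦ F|_{∂Ω}`, on the functions in `H¹(Ω)` that have a
representative `F` continuous on the closure of `Ω`. -/
def restrictionGraph {d : ℕ} (Ω : Set (E d)) : Submodule ℂ (H1 Ω × H12 Ω) where
  carrier := {p | ∃ F : E d → ℂ, ContinuousOn F (closure Ω) ∧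
    toL2 Ω p.1 =ᵐ[volume.restrict Ω] F ∧ p.2.1.fst =ᵐ[surface Ω] F}
  zero_mem' := ⟨0, continuousOn_const, Lp.coeFn_zero _ _ _, Lp.coeFn_zero _ _ _⟩
  add_mem' := by
    rintro p q ⟨F, h1, h2, h3⟩ ⟨G, h4, h5, h6⟩
    exact ⟨F + G, h1.add h4, (Lp.coeFn_add (toL2 Ω p.1) (toL2 Ω q.1)).trans (h2.add h5),
      (Lp.coeFn_add p.2.1.fst q.2.1.fst).trans (h3.add h6)⟩
  smul_mem' := by
    rintro c p ⟨F, h1, h2, h3⟩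
    exact ⟨c • F, h1.const_smul c, (Lp.coeFn_smul c (toL2 Ω p.1)).trans (h2.const_smul c),
      (Lp.coeFn_smul c p.2.1.fst).trans (h3.const_smul c)⟩

/-- The graph of the Dirichlet trace `γ : H¹(Ω) → H^{1/2}(∂Ω)`, the continuous extension of the
classical restriction: `γ f = g` iff there are `fₙ ∈ H¹(Ω) ∩ C(closure Ω)` with `fₙ → f` in `H¹(Ω)`
and `fₙ|_{∂Ω} → g` in `H^{1/2}(∂Ω)`. -/
def traceGraph {d : ℕ} (Ω : Set (E d)) : Submodule ℂ (H1 Ω × H12 Ω) :=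
  (restrictionGraph Ω).topologicalClosure

/-- `H¹_L(Ω) = {f ∈ H¹(Ω) : γ f ∈ L}`. -/
def H1L {d : ℕ} (Ω : Set (E d)) (L : Submodule ℂ (H12 Ω)) : Submodule ℂ (H1 Ω) where
  carrier := {f | ∃ g ∈ L, (f, g) ∈ traceGraph Ω}
  zero_mem' := ⟨0, L.zero_mem, (traceGraph Ω).zero_mem⟩
  add_mem' := by
    rintro f f' ⟨g, hg, h⟩ ⟨g', hg', h'⟩
    exact ⟨g + g', L.add_mem hg hg', (traceGraph Ω).add_mem h h'⟩
  smul_mem' := by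
    rintro c f ⟨g, hg, h⟩
    exact ⟨c • g, L.smul_mem c hg, (traceGraph Ω).smul_mem c h⟩

/-! ### Cube, simplex and antisymmetric functions -/

/-- The open cube `I_N = (0,1)^N`. -/
def cube (N : ℕ) : Set (E N) := {x | ∀ i, x i ∈ Ioo (0 : ℝ) 1}

/-- The open simplex `S_N = {0 < x₁ < ⋯ < x_N < 1}`. -/
def simplex (N : ℕ) : Set (E N) := {x | x ∈ cube N ∧ StrictMono fun i => x i}

/-- Permutation of coordinates, `σ(x₁, …, x_N) = (x_{σ(1)}, …, x_{σ(N)})`. -/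
def permMap {N : ℕ} (σ : Equiv.Perm (Fin N)) : E N ≃ₗᵢ[ℝ] E N :=
  LinearIsometryEquiv.piLpCongrLeft 2 ℝ ℝ σ.symm

theorem permMap_apply {N : ℕ} (σ : Equiv.Perm (Fin N)) (x : E N) (i : Fin N) :
    permMap σ x i = x (σ i) := rfl

theorem quasi_permMap {N : ℕ} (σ : Equiv.Perm (Fin N)) :
    Measure.QuasiMeasurePreserving (permMap σ) (volume.restrict (cube N))
      (volume.restrict (cube N)) := by
  have hs : permMap σ ⁻¹' cube N = cube N := by
    ext x
    simp only [cube, mem_preimage, mem_ofPred_eq, permMap_apply]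
    exact σ.forall_congr_right (q := fun i => x i ∈ Ioo (0 : ℝ) 1)
  have h := (permMap σ).measurePreserving.restrict_preimage_emb
    (permMap σ).toHomeomorph.measurableEmbedding (cube N)
  rw [hs] at h
  exact h.quasiMeasurePreserving

/-- The space `⋀^N L²(I)` of electronic wave functions: the antisymmetric functions in `L²(I_N)`,
`Ψ(x_{σ(1)}, …, x_{σ(N)}) = sgn(σ) Ψ(x₁, …, x_N)` for almost every `x` and every `σ`. -/
def antisym (N : ℕ) : Submodule ℂ (L2 (cube N)) where
  carrier := {Ψ | ∀ σ : Equiv.Perm (Fin N), ∀ᵐ x ∂(volume.restrict (cube N)),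
    Ψ (permMap σ x) = ((Equiv.Perm.sign σ : ℤ) : ℂ) * Ψ x}
  zero_mem' := by
    intro σ
    have h := Lp.coeFn_zero ℂ 2 (volume.restrict (cube N))
    filter_upwards [h, (quasi_permMap σ).ae h] with x h1 h2
    rw [h1, h2]
    simp
  add_mem' := by
    intro Ψ Φ hΨ hΦ σ
    have h := Lp.coeFn_add Ψ Φ
    filter_upwards [h, (quasi_permMap σ).ae h, hΨ σ, hΦ σ] with x h1 h2 h3 h4
    simp only [h1, h2, Pi.add_apply, h3, h4]
    ring
  smul_mem' := by
    intro c Ψ hΨ σ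
    have h := Lp.coeFn_smul c Ψ
    filter_upwards [h, (quasi_permMap σ).ae h, hΨ σ] with x h1 h2 h3
    simp only [h1, h2, Pi.smul_apply, h3, smul_eq_mul]
    ring

/-- `H¹_L(I_N) ∩ ⋀^N L²(I)`, with the norm of `H¹(I_N)`. -/
def fermionH1L (N : ℕ) (L : Submodule ℂ (H12 (cube N))) : Submodule ℂ (H1 (cube N)) :=
  H1L (cube N) L ⊓ (antisym N).comap (toL2 (cube N))

theorem simplex_subset_cube (N : ℕ) : simplex N ⊆ cube N := fun _ h => h.1

theorem coeFn_eq_on_simplex {N : ℕ} {f g : E N → ℂ} (h : f =ᵐ[volume.restrict (cube N)] g) :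
    f =ᵐ[volume.restrict (simplex N)] g :=
  ae_restrict_of_ae_restrict_of_subset (simplex_subset_cube N) h

/-- `H¹_L(S_N) = {Ψ|_{S_N} : Ψ ∈ H¹_L(I_N) ∩ ⋀^N L²(I)}`, with the norm of `H¹(S_N)`. -/
def simplexH1L (N : ℕ) (L : Submodule ℂ (H12 (cube N))) : Submodule ℂ (H1 (simplex N)) where
  carrier := {Φ | ∃ Ψ ∈ fermionH1L N L,
    toL2 (simplex N) Φ =ᵐ[volume.restrict (simplex N)] toL2 (cube N) Ψ}
  zero_mem' := ⟨0, Submodule.zero_mem _, (Lp.coeFn_zero _ _ _).trans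
    (coeFn_eq_on_simplex (Lp.coeFn_zero _ _ _)).symm⟩
  add_mem' := by
    rintro Φ Φ' ⟨Ψ, hΨ, h⟩ ⟨Ψ', hΨ', h'⟩
    exact ⟨Ψ + Ψ', Submodule.add_mem _ hΨ hΨ',
      ((Lp.coeFn_add (toL2 _ Φ) (toL2 _ Φ')).trans (h.add h')).trans
        (coeFn_eq_on_simplex
          (Lp.coeFn_add (toL2 _ Ψ) (toL2 _ Ψ'))).symm⟩
  smul_mem' := by
    rintro c Φ ⟨Ψ, hΨ, h⟩
    exact ⟨c • Ψ, Submodule.smul_mem _ c hΨ,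
      ((Lp.coeFn_smul c (toL2 _ Φ)).trans (h.const_smul c)).trans
        (coeFn_eq_on_simplex
          (Lp.coeFn_smul c (toL2 _ Ψ))).symm⟩

/-- The function `σ_# Ψ = Ψ ∘ σ⁻¹` on `σ(S_N)`, extended by zero. -/
def push {N : ℕ} (σ : Equiv.Perm (Fin N)) (Ψ : E N → ℂ) : E N → ℂ :=
  (permMap σ '' simplex N).indicator fun x => Ψ ((permMap σ).symm x)

/-- The antisymmetrized extension `(N!)^{-1/2} ∑_σ sgn(σ) σ_# Ψ`. -/
def antisymExt {N : ℕ} (Ψ : E N → ℂ) : E N → ℂ := fun x =>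
  ((√(N.factorial : ℝ))⁻¹ : ℝ) *
    ∑ σ : Equiv.Perm (Fin N), ((Equiv.Perm.sign σ : ℤ) : ℂ) * push σ Ψ x

end SimplexReduction

end

open MeasureTheory Set
open scoped ENNReal ContDiff

namespace SimplexReduction

/-! ### Weak gradients -/

/-! The inverse of the antisymmetrized extension is `√(N!)` times restriction to the simplex, and it
is this map that is shown to be a surjective isometry. Up to the null set where two coordinates
coincide, the cube is the disjoint union of the `N!` permuted simplices, so the integral of a
permutation invariant function over the cube is `N!` times its integral over the simplex
(`setLIntegral_cube`). For antisymmetric `Ψ` this applies to `|Ψ|²`, and also to `|∇Ψ|²`: testing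
against permuted test functions shows that a permutation only reorders the partial derivatives and
changes their common sign (`gradient_permMap_of_antisym`). Surjectivity is built into the definition
of `simplexH1L` as a space of restrictions, once weak gradients are known to be unique
(`toL2_injective`). In particular, gluing the pieces across the faces of the simplices never has to
be checked: `antisymExt_eq` recognizes the glued function as an `H¹` function that already exists.
-/

/-- The fundamental lemma of the calculus of variations, applied to the locally integrable
difference `g - h`. It gives both uniqueness of weak gradients and their transformation law under
permutations. -/
theorem ae_eq_of_forall_test {d : ℕ} {Ω : Set (E d)} (hΩ : IsOpen Ω) {g h : E d → ℂ}
    (hg : MemLp g 2 (volume.restrict Ω)) (hh : MemLp h 2 (volume.restrict Ω))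
    (H : ∀ φ : E d → ℝ, ContDiff ℝ ∞ φ → HasCompactSupport φ → tsupport φ ⊆ Ω →
      ∫ x in Ω, φ x • g x = ∫ x in Ω, φ x • h x) :
    g =ᵐ[volume.restrict Ω] h := by
  have hloc : LocallyIntegrableOn (g - h) Ω volume :=
    locallyIntegrableOn_of_locallyIntegrable_restrict ((hg.sub hh).locallyIntegrable (by norm_num))
  have key := hΩ.ae_eq_zero_of_integral_contDiff_smul_eq_zero hloc (fun φ h1 h2 h3 => by
    rw [← setIntegral_eq_integral_of_forall_compl_eq_zero (s := Ω) (fun x hx => by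
      rw [image_eq_zero_of_notMem_tsupport fun h => hx (h3 h), zero_smul])]
    simp only [Pi.sub_apply, smul_sub]
    rw [integral_sub (integrable_test_smul hg h1.continuous h2)
      (integrable_test_smul hh h1.continuous h2), H φ h1 h2 h3, sub_self])
  refine (ae_restrict_iff' hΩ.measurableSet).2 ?_
  filter_upwards [key] with x hx hxΩ
  exact sub_eq_zero.1 (hx hxΩ)

/-- An element of `H¹(Ω)` is determined by its class in `L²(Ω)`, for `Ω` open. -/
theorem toL2_injective {d : ℕ} {Ω : Set (E d)} (hΩ : IsOpen Ω) :
    Function.Injective (toL2 Ω) := by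
  rintro ⟨u, hu⟩ ⟨v, hv⟩ (h : u.fst = v.fst)
  have hs : u.snd = v.snd := by
    refine Lp.ext ?_
    have hi : ∀ i : Fin d, (fun x => u.snd x i) =ᵐ[volume.restrict Ω] fun x => v.snd x i := by
      intro i
      refine ae_eq_of_forall_test hΩ (memLp_coord _ i) (memLp_coord _ i) fun φ h1 h2 h3 => ?_
      have e1 := hu φ h1 h2 h3 i
      have e2 := hv φ h1 h2 h3 i
      rw [h] at e1
      exact neg_injective (e1.symm.trans e2)
    filter_upwards [ae_all_iff.2 hi] with x hx
    ext i
    exact hx i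
  exact Subtype.ext ((WithLp.equiv 2 _).injective (Prod.ext h hs))

theorem IsWeakGrad.congr_ae {d : ℕ} {Ω : Set (E d)} {f f' : E d → ℂ}
    {G G' : E d → EuclideanSpace ℂ (Fin d)} (h : IsWeakGrad Ω f G)
    (hf : f =ᵐ[volume.restrict Ω] f') (hG : G =ᵐ[volume.restrict Ω] G') :
    IsWeakGrad Ω f' G' := by
  intro φ h1 h2 h3 i
  have e1 : ∫ x in Ω, fderiv ℝ φ x (EuclideanSpace.single i 1) • f' x
      = ∫ x in Ω, fderiv ℝ φ x (EuclideanSpace.single i 1) • f x :=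
    integral_congr_ae (by filter_upwards [hf] with x hx; rw [hx])
  have e2 : ∫ x in Ω, φ x • G' x i = ∫ x in Ω, φ x • G x i :=
    integral_congr_ae (by filter_upwards [hG] with x hx; rw [hx])
  rw [e1, e2, h φ h1 h2 h3 i]

/-- A test function supported in the smaller set is also one for the larger set, and the integrals
over either set equal those over the whole space. -/
theorem IsWeakGrad.mono {d : ℕ} {Ω Ω' : Set (E d)} {f : E d → ℂ}
    {G : E d → EuclideanSpace ℂ (Fin d)} (h : IsWeakGrad Ω f G) (hs : Ω' ⊆ Ω) :
    IsWeakGrad Ω' f G := by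
  intro φ h1 h2 h3 i
  have e1 : ∀ A : Set (E d), tsupport φ ⊆ A →
      ∫ x in A, fderiv ℝ φ x (EuclideanSpace.single i 1) • f x
        = ∫ x, fderiv ℝ φ x (EuclideanSpace.single i 1) • f x := fun A hA =>
    setIntegral_eq_integral_of_forall_compl_eq_zero fun x hx => by
      rw [fderiv_of_notMem_tsupport ℝ fun h => hx (hA h)]
      simp
  have e2 : ∀ A : Set (E d), tsupport φ ⊆ A →
      ∫ x in A, φ x • G x i = ∫ x, φ x • G x i := fun A hA =>
    setIntegral_eq_integral_of_forall_compl_eq_zero fun x hx => by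
      rw [image_eq_zero_of_notMem_tsupport fun h => hx (hA h), zero_smul]
  have := h φ h1 h2 (h3.trans hs) i
  rwa [e1 _ (h3.trans hs), e2 _ (h3.trans hs), ← e1 _ h3, ← e2 _ h3] at this

/-! ### Restriction to a subset -/

/-- Restriction of `L²` functions to a smaller set. -/
noncomputable def restrictLp {d : ℕ} {F : Type*} [NormedAddCommGroup F] [NormedSpace ℂ F]
    {Ω Ω' : Set (E d)} (hs : Ω' ⊆ Ω) : Lp F 2 (volume.restrict Ω) →ₗ[ℂ] Lp F 2 (volume.restrict Ω') where
  toFun f := ((Lp.memLp f).mono_measure (Measure.restrict_mono hs le_rfl)).toLp f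
  map_add' f g := by
    rw [← MemLp.toLp_add]
    exact (MemLp.toLp_eq_toLp_iff _ _).2
      (ae_restrict_of_ae_restrict_of_subset hs (Lp.coeFn_add f g))
  map_smul' c f := by
    rw [RingHom.id_apply, ← MemLp.toLp_const_smul]
    exact (MemLp.toLp_eq_toLp_iff _ _).2
      (ae_restrict_of_ae_restrict_of_subset hs (Lp.coeFn_smul c f))

theorem coeFn_restrictLp {d : ℕ} {F : Type*} [NormedAddCommGroup F] [NormedSpace ℂ F]
    {Ω Ω' : Set (E d)} (hs : Ω' ⊆ Ω) (f : Lp F 2 (volume.restrict Ω)) :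
    restrictLp hs f =ᵐ[volume.restrict Ω'] f :=
  ((Lp.memLp f).mono_measure (Measure.restrict_mono hs le_rfl)).coeFn_toLp

/-- Restriction `H¹(Ω) → H¹(Ω')` for `Ω' ⊆ Ω`. -/
noncomputable def restrictH1 {d : ℕ} {Ω Ω' : Set (E d)} (hs : Ω' ⊆ Ω) : H1 Ω →ₗ[ℂ] H1 Ω' where
  toFun u := ⟨WithLp.toLp 2 (restrictLp hs u.1.fst, restrictLp hs u.1.snd),
    ((show IsWeakGrad Ω u.1.fst u.1.snd from u.2).mono hs).congr_ae
      (coeFn_restrictLp hs _).symm (coeFn_restrictLp hs _).symm⟩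
  map_add' u v := by
    refine Subtype.ext ((WithLp.equiv 2 _).injective (Prod.ext ?_ ?_))
    · exact map_add (restrictLp hs) u.1.fst v.1.fst
    · exact map_add (restrictLp hs) u.1.snd v.1.snd
  map_smul' c u := by
    refine Subtype.ext ((WithLp.equiv 2 _).injective (Prod.ext ?_ ?_))
    · exact map_smul (restrictLp hs) c u.1.fst
    · exact map_smul (restrictLp hs) c u.1.snd

theorem coeFn_toL2_restrictH1 {d : ℕ} {Ω Ω' : Set (E d)} (hs : Ω' ⊆ Ω) (u : H1 Ω) :
    toL2 Ω' (restrictH1 hs u) =ᵐ[volume.restrict Ω'] toL2 Ω u :=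
  coeFn_restrictLp hs _

/-! ### The cube as a union of permuted simplices -/

theorem isOpen_cube (N : ℕ) : IsOpen (cube N) := by
  have : cube N = ⋂ i, {x : E N | x i ∈ Ioo (0 : ℝ) 1} := by ext; simp [cube]
  rw [this]
  exact isOpen_iInter_of_finite fun i => isOpen_Ioo.preimage (by fun_prop)

theorem isOpen_simplex (N : ℕ) : IsOpen (simplex N) := by
  have : simplex N = cube N ∩ ⋂ i, ⋂ j, {x : E N | i < j → x i < x j} := by
    ext x
    simp [simplex, StrictMono]
  rw [this]
  refine (isOpen_cube N).inter (isOpen_iInter_of_finite fun i => isOpen_iInter_of_finite fun j => ?_)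
  by_cases hij : i < j
  · simpa [hij] using isOpen_lt (f := fun x : E N => x i) (g := fun x => x j)
      (by fun_prop) (by fun_prop)
  · simp [hij]

theorem permMap_symm {N : ℕ} (σ : Equiv.Perm (Fin N)) : (permMap σ).symm = permMap σ⁻¹ :=
  LinearIsometryEquiv.ext fun x => by
    rw [LinearIsometryEquiv.symm_apply_eq]
    ext i
    simp [permMap_apply]

theorem permMap_mem_cube {N : ℕ} (σ : Equiv.Perm (Fin N)) {x : E N} :
    permMap σ x ∈ cube N ↔ x ∈ cube N :=
  σ.forall_congr_right (q := fun i => x i ∈ Ioo (0 : ℝ) 1)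

theorem mem_image_simplex {N : ℕ} (σ : Equiv.Perm (Fin N)) {x : E N} :
    x ∈ permMap σ '' simplex N ↔ permMap σ⁻¹ x ∈ simplex N := by
  rw [← permMap_symm]
  exact (permMap σ).toEquiv.image_eq_preimage_symm (simplex N) ▸ Iff.rfl

theorem eq_of_mem_image_simplex {N : ℕ} {σ τ : Equiv.Perm (Fin N)} {x : E N}
    (hσ : x ∈ permMap σ '' simplex N) (hτ : x ∈ permMap τ '' simplex N) : σ = τ := by
  rw [mem_image_simplex] at hσ hτ
  have h := Tuple.unique_monotone (f := fun i => x i) (σ := σ⁻¹) (τ := τ⁻¹)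
    hσ.2.monotone hτ.2.monotone
  -- Strict monotonicity after sorting makes the coordinates distinct, so the sorting permutation is
  -- unique.
  have hinj : Function.Injective fun i => x i := by
    have := hσ.2.injective.comp σ.injective
    intro i j hij
    exact this (by simpa [permMap_apply] using hij)
  exact inv_injective (Equiv.ext fun i => hinj (congrFun h i))

theorem volume_setOf_coord_eq {N : ℕ} {i j : Fin N} (hij : i ≠ j) :
    volume {x : E N | x i = x j} = 0 := by
  let l : E N →ₗ[ℝ] ℝ := (EuclideanSpace.proj i - EuclideanSpace.proj j : E N →L[ℝ] ℝ)
  have hl : {x : E N | x i = x j} = (LinearMap.ker l : Set (E N)) := by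
    ext x
    simp [l, sub_eq_zero]
  rw [hl]
  -- A proper subspace is null; the `i`-th basis vector witnesses properness.
  refine Measure.addHaar_submodule _ _ fun htop => ?_
  have : EuclideanSpace.single i (1 : ℝ) ∈ LinearMap.ker l := htop ▸ Submodule.mem_top
  simp [l, hij.symm] at this

/-- Almost every point has distinct coordinates, and sorting them moves it into the simplex. -/
theorem ae_exists_mem_image_simplex (N : ℕ) :
    ∀ᵐ x ∂(volume.restrict (cube N)), ∃ σ, x ∈ permMap σ '' simplex N := by
  have h : ∀ᵐ x : E N, ∀ i j, i ≠ j → x i ≠ x j := by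
    refine ae_all_iff.2 fun i => ae_all_iff.2 fun j => ?_
    by_cases hij : i = j
    · simp [hij]
    · simpa [hij, ae_iff] using volume_setOf_coord_eq hij
  refine (ae_restrict_iff' (isOpen_cube N).measurableSet).2 ?_
  filter_upwards [h] with x hx hxc
  refine ⟨(Tuple.sort fun i => x i)⁻¹, ?_⟩
  rw [mem_image_simplex, inv_inv]
  refine ⟨(permMap_mem_cube _).2 hxc, (Tuple.monotone_sort fun i => x i).strictMono_of_injective ?_⟩
  refine Function.Injective.comp (fun i j hij => ?_) (Equiv.injective _)
  by_contra hne
  exact hx i j hne hij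

/-- The integral over the cube of a permutation invariant function is `N!` times its integral over
the simplex. -/
theorem setLIntegral_cube {N : ℕ} {h : E N → ℝ≥0∞}
    (hh : ∀ σ : Equiv.Perm (Fin N), ∀ᵐ x ∂(volume.restrict (cube N)), h (permMap σ x) = h x) :
    ∫⁻ x in cube N, h x = N.factorial * ∫⁻ x in simplex N, h x := by
  have hU : cube N =ᵐ[volume] ⋃ σ, permMap σ '' simplex N := by
    have h1 := (ae_restrict_iff' (isOpen_cube N).measurableSet).1 (ae_exists_mem_image_simplex N)
    filter_upwards [h1] with x hx
    refine propext ⟨fun hc => mem_iUnion.2 (hx hc), fun hc => ?_⟩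
    obtain ⟨σ, hσ⟩ := mem_iUnion.1 hc
    exact (permMap_mem_cube σ⁻¹).1 ((mem_image_simplex σ).1 hσ).1
  rw [setLIntegral_congr hU, lintegral_iUnion (s := fun σ => permMap σ '' simplex N)
    (fun σ => ((permMap σ).toHomeomorph.isOpenMap _ (isOpen_simplex N)).measurableSet)
    (fun σ τ hne => Set.disjoint_left.2 fun x h1 h2 => hne (eq_of_mem_image_simplex h1 h2)),
    tsum_fintype]
  have hσ : ∀ σ : Equiv.Perm (Fin N),
      ∫⁻ x in permMap σ '' simplex N, h x = ∫⁻ x in simplex N, h x := by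
    intro σ
    rw [← (permMap σ).measurePreserving.setLIntegral_comp_emb
      (permMap σ).toHomeomorph.measurableEmbedding]
    exact lintegral_congr_ae
      (ae_restrict_of_ae_restrict_of_subset (simplex_subset_cube N) (hh σ))
  simp [hσ, Fintype.card_perm]

theorem norm_sq_eq_toReal_lintegral {d : ℕ} {F : Type*} [NormedAddCommGroup F] {Ω : Set (E d)}
    (f : Lp F 2 (volume.restrict Ω)) :
    ‖f‖ ^ 2 = (∫⁻ x in Ω, ‖f x‖ₑ ^ 2).toReal := by
  rw [Lp.norm_def, eLpNorm_eq_lintegral_rpow_enorm_toReal (by norm_num) (by norm_num),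
    ← ENNReal.toReal_pow, ← ENNReal.rpow_natCast, ← ENNReal.rpow_mul]
  norm_num

theorem norm_sq_eq_factorial_mul {N : ℕ} {F : Type*} [NormedAddCommGroup F] [NormedSpace ℂ F]
    (f : Lp F 2 (volume.restrict (cube N)))
    (hf : ∀ σ : Equiv.Perm (Fin N), ∀ᵐ x ∂(volume.restrict (cube N)), ‖f (permMap σ x)‖ = ‖f x‖) :
    ‖f‖ ^ 2 = N.factorial * ‖restrictLp (simplex_subset_cube N) f‖ ^ 2 := by
  rw [norm_sq_eq_toReal_lintegral, norm_sq_eq_toReal_lintegral, setLIntegral_cube,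
    ENNReal.toReal_mul, ENNReal.toReal_natCast]
  · congr 2
    refine lintegral_congr_ae ?_
    filter_upwards [coeFn_restrictLp (simplex_subset_cube N) f] with x hx
    rw [hx]
  · intro σ
    filter_upwards [hf σ] with x hx
    rw [← ofReal_norm, hx, ofReal_norm]

/-! ### The gradient of an antisymmetric function -/

theorem measurePreserving_permMap_cube {N : ℕ} (σ : Equiv.Perm (Fin N)) :
    MeasurePreserving (permMap σ) (volume.restrict (cube N)) (volume.restrict (cube N)) := by
  have h := (permMap σ).measurePreserving.restrict_preimage_emb
    (permMap σ).toHomeomorph.measurableEmbedding (cube N)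
  rwa [show permMap σ ⁻¹' cube N = cube N from Set.ext fun x => permMap_mem_cube σ] at h

theorem permMap_inv_single {N : ℕ} (σ : Equiv.Perm (Fin N)) (i : Fin N) :
    permMap σ⁻¹ (EuclideanSpace.single i (1 : ℝ)) = EuclideanSpace.single (σ i) 1 := by
  ext k
  rw [permMap_apply]
  simp [Equiv.symm_apply_eq]

/-- Test functions composed with a coordinate permutation: the weak derivative of `f ∘ σ` in
direction `σ i` is `∂ᵢf ∘ σ`. -/
theorem IsWeakGrad.integral_permMap {N : ℕ} {f : E N → ℂ} {G : E N → EuclideanSpace ℂ (Fin N)}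
    (h : IsWeakGrad (cube N) f G) (σ : Equiv.Perm (Fin N)) {φ : E N → ℝ} (h1 : ContDiff ℝ ∞ φ)
    (h2 : HasCompactSupport φ) (h3 : tsupport φ ⊆ cube N) (i : Fin N) :
    ∫ x in cube N, fderiv ℝ φ x (EuclideanSpace.single (σ i) 1) • f (permMap σ x)
      = - ∫ x in cube N, φ x • G (permMap σ x) i := by
  -- With this test function, the substitution `x ↦ σ x` in the weak gradient identity turns `ψ`
  -- back into `φ`.
  let ψ : E N → ℝ := φ ∘ permMap σ⁻¹
  have hψ1 : ContDiff ℝ ∞ ψ := h1.comp (permMap σ⁻¹).contDiff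
  have hψ2 : HasCompactSupport ψ := h2.comp_homeomorph (permMap σ⁻¹).toHomeomorph
  have hψ3 : tsupport ψ ⊆ cube N := fun x hx =>
    (permMap_mem_cube σ⁻¹).1 (h3 (tsupport_comp_subset_preimage φ (permMap σ⁻¹).continuous hx))
  have hinv : ∀ x, permMap σ⁻¹ (permMap σ x) = x := fun x => by
    rw [← permMap_symm, LinearIsometryEquiv.symm_apply_apply]
  have hd : ∀ x, fderiv ℝ ψ (permMap σ x) (EuclideanSpace.single i 1)
      = fderiv ℝ φ x (EuclideanSpace.single (σ i) 1) := by
    intro x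
    have hφ : HasFDerivAt φ (fderiv ℝ φ x) (permMap σ⁻¹ (permMap σ x)) := by
      rw [hinv]
      exact (h1.differentiable (by simp) x).hasFDerivAt
    have := hφ.comp (permMap σ x)
      (permMap σ⁻¹).toContinuousLinearEquiv.toContinuousLinearMap.hasFDerivAt
    rw [HasFDerivAt.fderiv (f := ψ) this, ← permMap_inv_single]
    rfl
  have key := h ψ hψ1 hψ2 hψ3 i
  have hc : ∀ g : E N → ℂ, ∫ x in cube N, g x = ∫ x in cube N, g (permMap σ x) := fun g =>
    ((measurePreserving_permMap_cube σ).integral_comp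
      (permMap σ).toHomeomorph.measurableEmbedding g).symm
  rw [hc, hc fun x => ψ x • G x i] at key
  simpa only [hd, ψ, Function.comp_apply, hinv] using key

theorem norm_sign {N : ℕ} (σ : Equiv.Perm (Fin N)) : ‖((Equiv.Perm.sign σ : ℤ) : ℂ)‖ = 1 := by
  rcases Int.units_eq_one_or (Equiv.Perm.sign σ) with h | h <;> simp [h]

theorem sign_mul_self {N : ℕ} (σ : Equiv.Perm (Fin N)) :
    ((Equiv.Perm.sign σ : ℤ) : ℂ) * ((Equiv.Perm.sign σ : ℤ) : ℂ) = 1 := by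
  rcases Int.units_eq_one_or (Equiv.Perm.sign σ) with h | h <;> simp [h]

/-- Formally, this differentiates `Ψ ∘ σ = sgn(σ) Ψ` in direction `σ i`; weakly, both sides have the
same integral against every test function. -/
theorem gradient_permMap_of_antisym {N : ℕ} (u : H1 (cube N))
    (hu : toL2 (cube N) u ∈ antisym N) (σ : Equiv.Perm (Fin N)) (i : Fin N) :
    ∀ᵐ x ∂(volume.restrict (cube N)),
      u.1.snd (permMap σ x) i = ((Equiv.Perm.sign σ : ℤ) : ℂ) * u.1.snd x (σ i) := by
  refine ae_eq_of_forall_test (isOpen_cube N)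
    ((memLp_coord u.1.snd i).comp_measurePreserving (measurePreserving_permMap_cube σ))
    ((memLp_coord u.1.snd (σ i)).const_mul _) fun φ h1 h2 h3 => neg_injective ?_
  have hw : IsWeakGrad (cube N) u.1.fst u.1.snd := u.2
  have e1 := hw.integral_permMap σ h1 h2 h3 i
  have e2 := hw φ h1 h2 h3 (σ i)
  calc - ∫ x in cube N, φ x • u.1.snd (permMap σ x) i
      = ∫ x in cube N, fderiv ℝ φ x (EuclideanSpace.single (σ i) 1) • u.1.fst (permMap σ x) :=
        e1.symm
    _ = ∫ x in cube N, ((Equiv.Perm.sign σ : ℤ) : ℂ) *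
          fderiv ℝ φ x (EuclideanSpace.single (σ i) 1) • u.1.fst x := by
        refine integral_congr_ae ?_
        filter_upwards [hu σ] with x hx
        change u.1.fst (permMap σ x) = _ * u.1.fst x at hx
        rw [hx, mul_smul_comm]
    _ = - ∫ x in cube N, φ x • (((Equiv.Perm.sign σ : ℤ) : ℂ) * u.1.snd x (σ i)) := by
        simp only [← mul_smul_comm]
        rw [integral_const_mul, integral_const_mul, e2, mul_neg]

theorem norm_gradient_permMap_of_antisym {N : ℕ} (u : H1 (cube N))
    (hu : toL2 (cube N) u ∈ antisym N) (σ : Equiv.Perm (Fin N)) :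
    ∀ᵐ x ∂(volume.restrict (cube N)), ‖u.1.snd (permMap σ x)‖ = ‖u.1.snd x‖ := by
  filter_upwards [ae_all_iff.2 (gradient_permMap_of_antisym u hu σ)] with x hx
  rw [EuclideanSpace.norm_eq, EuclideanSpace.norm_eq]
  simp only [hx, norm_mul, norm_sign, one_mul]
  rw [Equiv.sum_comp σ fun i => ‖u.1.snd x i‖ ^ 2]

theorem norm_sq_antisym {N : ℕ} (u : H1 (cube N)) (hu : toL2 (cube N) u ∈ antisym N) :
    ‖u‖ ^ 2 = N.factorial * ‖restrictH1 (simplex_subset_cube N) u‖ ^ 2 := by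
  rw [Submodule.coe_norm, Submodule.coe_norm, WithLp.prod_norm_sq_eq_of_L2,
    WithLp.prod_norm_sq_eq_of_L2, mul_add,
    norm_sq_eq_factorial_mul u.1.snd (norm_gradient_permMap_of_antisym u hu),
    norm_sq_eq_factorial_mul u.1.fst fun σ => ?_]
  · rfl
  · filter_upwards [hu σ] with x hx
    change u.1.fst (permMap σ x) = _ * u.1.fst x at hx
    rw [hx, norm_mul, norm_sign, one_mul]

/-! ### The antisymmetrized extension -/

theorem antisymExt_eq {N : ℕ} {Φ : E N → ℂ} {Ψ : L2 (cube N)} (hΨ : Ψ ∈ antisym N)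
    (h : Φ =ᵐ[volume.restrict (simplex N)] fun x => (√(N.factorial : ℝ) : ℂ) * Ψ x) :
    antisymExt Φ =ᵐ[volume.restrict (cube N)] Ψ := by
  -- Stated as an implication on the whole cube, the hypothesis can be pulled back along every
  -- coordinate permutation.
  have h' : ∀ᵐ x ∂(volume.restrict (cube N)), x ∈ simplex N →
      Φ x = (√(N.factorial : ℝ) : ℂ) * Ψ x :=
    ae_restrict_of_ae ((ae_restrict_iff' (isOpen_simplex N).measurableSet).1 h)
  filter_upwards [ae_exists_mem_image_simplex N,
    ae_all_iff.2 fun σ : Equiv.Perm (Fin N) => (quasi_permMap σ).ae h', ae_all_iff.2 hΨ]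
    with x ⟨σ, hσ⟩ hΦ hanti
  have hc : (√(N.factorial : ℝ) : ℂ) ≠ 0 := by
    exact_mod_cast (Real.sqrt_pos.2 (by exact_mod_cast N.factorial_pos)).ne'
  have hval : push σ Φ x
      = (√(N.factorial : ℝ) : ℂ) * (((Equiv.Perm.sign σ : ℤ) : ℂ) * Ψ x) := by
    rw [push, indicator_of_mem hσ, permMap_symm, hΦ σ⁻¹ ((mem_image_simplex σ).1 hσ), hanti σ⁻¹,
      Equiv.Perm.sign_inv]
  -- Since `x` lies in only one permuted simplex, one term survives. Its sign cancels the sign from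
  -- antisymmetry, and the two factors `√(N!)` cancel.
  rw [antisymExt, Finset.sum_eq_single σ]
  · rw [hval]
    calc _ = ((√(N.factorial : ℝ) : ℂ)⁻¹ * √(N.factorial : ℝ)) *
          (((Equiv.Perm.sign σ : ℤ) : ℂ) * ((Equiv.Perm.sign σ : ℤ) : ℂ)) * Ψ x := by
          push_cast
          ring
      _ = Ψ x := by rw [inv_mul_cancel₀ hc, sign_mul_self, one_mul, one_mul]
  · intro τ _ hne
    rw [push, indicator_of_notMem fun hτ => hne (eq_of_mem_image_simplex hτ hσ), mul_zero]
  · simp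

/-! ### The isometry -/

/-- The map `Ψ ↦ √(N!) Ψ|_{S_N}`, the inverse of the antisymmetrized extension. -/
noncomputable def scaledRestriction (N : ℕ) (L : Submodule ℂ (H12 (cube N))) :
    fermionH1L N L →ₗᵢ[ℂ] simplexH1L N L where
  toLinearMap := (((√(N.factorial : ℝ) : ℂ) •
      restrictH1 (simplex_subset_cube N)).comp (fermionH1L N L).subtype).codRestrict _ fun u =>
    Submodule.smul_mem _ _ ⟨u, u.2, coeFn_toL2_restrictH1 _ _⟩
  norm_map' u := by
    refine (sq_eq_sq₀ (norm_nonneg _) (norm_nonneg _)).1 ?_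
    change ‖(√(N.factorial : ℝ) : ℂ) • restrictH1 (simplex_subset_cube N) u.1‖ ^ 2 = ‖u.1‖ ^ 2
    rw [norm_sq_antisym u.1 u.2.2, norm_smul, mul_pow, Complex.norm_real, Real.norm_eq_abs, sq_abs,
      Real.sq_sqrt (Nat.cast_nonneg _)]

theorem coe_scaledRestriction {N : ℕ} {L : Submodule ℂ (H12 (cube N))} (u : fermionH1L N L) :
    (scaledRestriction N L u : H1 (simplex N)) =
      (√(N.factorial : ℝ) : ℂ) • restrictH1 (simplex_subset_cube N) u.1 :=
  rfl

theorem coeFn_toL2_scaledRestriction {N : ℕ} {L : Submodule ℂ (H12 (cube N))}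
    (u : fermionH1L N L) :
    toL2 (simplex N) (scaledRestriction N L u : H1 (simplex N))
      =ᵐ[volume.restrict (simplex N)]
        fun x => (√(N.factorial : ℝ) : ℂ) * toL2 (cube N) u.1 x := by
  rw [coe_scaledRestriction, map_smul]
  filter_upwards [Lp.coeFn_smul (√(N.factorial : ℝ) : ℂ)
      (toL2 (simplex N) (restrictH1 (simplex_subset_cube N) u.1)),
    coeFn_toL2_restrictH1 (simplex_subset_cube N) u.1] with x h1 h2
  rw [h1, Pi.smul_apply, h2, smul_eq_mul]

theorem scaledRestriction_surjective (N : ℕ) (L : Submodule ℂ (H12 (cube N))) :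
    Function.Surjective (scaledRestriction N L) := by
  rintro ⟨Φ, Ψ, hΨ, h⟩
  have hc : (√(N.factorial : ℝ) : ℂ) ≠ 0 := by
    exact_mod_cast (Real.sqrt_pos.2 (by exact_mod_cast N.factorial_pos)).ne'
  refine ⟨(√(N.factorial : ℝ) : ℂ)⁻¹ • ⟨Ψ, hΨ⟩, Subtype.ext ?_⟩
  rw [map_smul, Submodule.coe_smul, coe_scaledRestriction, inv_smul_smul₀ hc]
  -- The definition of `simplexH1L` matches only function values; openness of the simplex makes the
  -- gradients agree too.
  exact toL2_injective (isOpen_simplex N)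
    (Lp.ext ((coeFn_toL2_restrictH1 (simplex_subset_cube N) Ψ).trans h.symm))

end SimplexReduction

open SimplexReduction in
theorem mainTheorem8 (N : ℕ) (L : Submodule ℂ (H12 (cube N)))
    (hL : IsClosed (L : Set (H12 (cube N)))) :
    ∃ T : simplexH1L N L ≃ₗᵢ[ℂ] fermionH1L N L, ∀ Ψ : simplexH1L N L,
      toL2 (cube N) (T Ψ : H1 (cube N)) =ᵐ[MeasureTheory.volume.restrict (cube N)]
        antisymExt (toL2 (simplex N) (Ψ : H1 (simplex N))) := by
  let e : fermionH1L N L ≃ₗᵢ[ℂ] simplexH1L N L :=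
    LinearIsometryEquiv.ofSurjective _ (scaledRestriction_surjective N L)
  refine ⟨e.symm, fun Ψ => ?_⟩
  -- Writing `Ψ` as the scaled restriction of `u` reduces the formula for the inverse to recovering
  -- `u` from its values on the simplex.
  obtain ⟨u, rfl⟩ := e.surjective Ψ
  rw [e.symm_apply_apply]
  exact (antisymExt_eq u.2.2 (coeFn_toL2_scaledRestriction u)).symm
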